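/- **Theorem 2.4.** Let $n\ge 2$ be an integer and $0<\sigma<1$. For a compact set $\Lambda\subset\mathbb R^n$ define the fractional capacity $$\mathrm{Cap}_\sigma(\Lambda):=\inf\left\{\int_{\mathbb R^n}|\xi|^{2\sigma}|\hat f(\xi)|^2\,d\xi\;:\; f\in C_c^\infty(\mathbb R^n),\ f \text{ real-valued},\ f(x)\ge 1\ \text{for all } x\in\Lambda\right\},$$ where $\hat f(\xi)=(2\pi)^{-n/2}\int_{\mathbb R^n}e^{-i x\cdot\xi}f(x)\,dx$. If $\Lambda\subset\mathbb R^n$ is compact and $\mathrm{Cap}_\sigma(\Lambda)=0$, then the $s$-dimensional Hausdorff measure satisfies $\mathcal H^s(\Lambda)=0$ for every real $s>n-2\sigma$. Consequently, the Hausdorff dimension of $\Lambda$ is at most $n-2\sigma$. -/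

import Mathlib

open MeasureTheory
open scoped ENNReal ContDiff FourierTransform

/-- The unitary Fourier transform `(2π)^(-n/2) ∫ e^(-i⟨x, ξ⟩) f(x) dx` of a real function on `ℝⁿ`,
written through Mathlib's `𝓕 f ξ = ∫ e^(-2πi⟨x, ξ⟩) f(x) dx`. -/
noncomputable def fourierHat {n : ℕ} (f : EuclideanSpace ℝ (Fin n) → ℝ)
    (ξ : EuclideanSpace ℝ (Fin n)) : ℂ :=
  (((2 * Real.pi) ^ (-(n : ℝ) / 2) : ℝ) : ℂ) *
    𝓕 (fun x : EuclideanSpace ℝ (Fin n) => (f x : ℂ)) ((2 * Real.pi)⁻¹ • ξ)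

/-- The fractional energy `∫ |ξ|^(2σ) |f̂(ξ)|² dξ`, as an extended nonnegative number. -/
noncomputable def fractionalEnergy {n : ℕ} (σ : ℝ) (f : EuclideanSpace ℝ (Fin n) → ℝ) : ℝ≥0∞ :=
  ∫⁻ ξ : EuclideanSpace ℝ (Fin n), ENNReal.ofReal (‖ξ‖ ^ (2 * σ) * ‖fourierHat f ξ‖ ^ 2)

/-- The fractional capacity `Cap_σ(Λ)`: the infimum of the fractional energy over all real
`f ∈ C_c^∞(ℝⁿ)` with `f ≥ 1` on `Λ`. -/
noncomputable def fractionalCapacity {n : ℕ} (σ : ℝ) (Λ : Set (EuclideanSpace ℝ (Fin n))) : ℝ≥0∞ :=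
  sInf {E | ∃ f : EuclideanSpace ℝ (Fin n) → ℝ, ContDiff ℝ ∞ f ∧ HasCompactSupport f ∧
    (∀ x ∈ Λ, 1 ≤ f x) ∧ E = fractionalEnergy σ f}

section FractionalCapacity

open Metric Filter Set
open scoped Topology RealInnerProductSpace

variable {V : Type*} [NormedAddCommGroup V] [InnerProductSpace ℝ V] [FiniteDimensional ℝ V]
  [MeasurableSpace V] [BorelSpace V]

/-! The Fourier energy dominates a multiple of the Gagliardo double integral of |f(y+h) - f(y)|²
|h|^(-d-2σ), by Plancherel in y and scaling of the symbol in h. In this local form it can be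
restricted to balls. Write E(B) for the integral of the density over B.

By Jensen, the averages of f over the balls of radii r/2 and r about x differ by at most a multiple
of (r^(2σ-d) E(B(x,r)))^(1/2). Telescoping over dyadic scales joins f(x), the limit at small radii,
to 0, the limit at large radii. Large scales sum because 2σ < d. If E(B(x,r)) < δ r^s at all small
r, small scales sum because s > d - 2σ. For small δ and total energy this forces f(x) < 1
(`exists_radius_lintegral_gagliardoDensity_ge`).

So every point of Λ has a small ball with E at least δ r^s. A Vitali subfamily is disjoint, hence
the sum of r^s is at most the total energy over δ, which is arbitrarily small
(`exists_finset_cover_sum_rpow_le`). -/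

/-- The density `y ↦ ∫ |f(y+h) - f(y)|² |h|^(-d-2σ) dh` of the Gagliardo energy of `f`. -/
noncomputable def gagliardoDensity (σ : ℝ) (f : V → ℝ) (y : V) : ℝ≥0∞ :=
  ∫⁻ h : V, ‖f (y + h) - f y‖ₑ ^ 2 *
    ENNReal.ofReal (‖h‖ ^ (-((Module.finrank ℝ V : ℝ) + 2 * σ)))

/-! ### Gagliardo energy versus Fourier energy -/

theorem fourier_comp_add_right_sub (g : SchwartzMap V ℂ) (h : V) (u : SchwartzMap V ℂ)
    (hu : ∀ x, u x = g (x + h)) (ξ : V) :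
    𝓕 (u - g) ξ = ((Real.fourierChar ⟪h, ξ⟫ : ℂ) - 1) * 𝓕 (g : V → ℂ) ξ := by
  have h1 : 𝓕 (u - g) = 𝓕 u - 𝓕 g := (SchwartzMap.fourierTransformCLM ℂ).map_sub u g
  have h2 : (u : V → ℂ) = (g : V → ℂ) ∘ fun x => x + h := funext hu
  have h3 := congrFun (VectorFourier.fourierIntegral_comp_add_right Real.fourierChar volume
    (innerₗ V) (g : V → ℂ) h) ξ
  have h4 : 𝓕 (u : V → ℂ) ξ = Real.fourierChar ⟪h, ξ⟫ • 𝓕 (g : V → ℂ) ξ := by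
    rw [h2]; exact h3
  rw [h1, sub_apply, SchwartzMap.fourier_coe, SchwartzMap.fourier_coe, h4,
    Circle.smul_def, smul_eq_mul]
  ring

theorem lintegral_enorm_sq_fourier (g : SchwartzMap V ℂ) :
    ∫⁻ ξ, ‖𝓕 g ξ‖ₑ ^ 2 = ∫⁻ x, ‖g x‖ₑ ^ 2 := by
  have key : ∀ u : SchwartzMap V ℂ, ∫⁻ x, ‖u x‖ₑ ^ 2 = ENNReal.ofReal (∫ x, ‖u x‖ ^ 2) := by
    intro u
    rw [ofReal_integral_eq_lintegral_ofReal (u.memLp 2 volume).norm.integrable_sq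
      (Eventually.of_forall fun x => sq_nonneg _)]
    simp only [ENNReal.ofReal_pow (norm_nonneg _), ofReal_norm]
  rw [key, key, SchwartzMap.integral_norm_sq_fourier]

/-- **Plancherel** for the increments of a test function. -/
theorem lintegral_enorm_sq_increment {f : V → ℝ} (hf : ContDiff ℝ ∞ f) (hc : HasCompactSupport f)
    (h : V) :
    ∫⁻ x, ‖f (x + h) - f x‖ₑ ^ 2 =
      ∫⁻ ξ, ‖(Real.fourierChar ⟪h, ξ⟫ : ℂ) - 1‖ₑ ^ 2 *
        ‖𝓕 (fun x => (f x : ℂ)) ξ‖ₑ ^ 2 := by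
  have hfC : ContDiff ℝ ∞ fun x => (f x : ℂ) := Complex.ofRealCLM.contDiff.comp hf
  have hcC : HasCompactSupport fun x => (f x : ℂ) := hc.comp_left Complex.ofReal_zero
  let g : SchwartzMap V ℂ := hcC.toSchwartzMap hfC
  have hfC' : ContDiff ℝ ∞ fun x => (f (x + h) : ℂ) :=
    hfC.comp (contDiff_id.add contDiff_const)
  have hcC' : HasCompactSupport fun x => (f (x + h) : ℂ) :=
    hcC.comp_homeomorph (Homeomorph.addRight h)
  let u : SchwartzMap V ℂ := hcC'.toSchwartzMap hfC'
  have := lintegral_enorm_sq_fourier (u - g)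
  simp only [fourier_comp_add_right_sub g h u (fun _ => rfl), enorm_mul, mul_pow] at this
  rw [show (fun x => (f x : ℂ)) = (g : V → ℂ) from rfl, this]
  refine lintegral_congr fun x => ?_
  rw [sub_apply, show u x = (f (x + h) : ℂ) from rfl, show g x = (f x : ℂ) from rfl,
    ← Complex.ofReal_sub, ← ofReal_norm, ← ofReal_norm, Complex.norm_real]

theorem norm_fourierChar_sub_one_sq_le (t : ℝ) :
    ‖(Real.fourierChar t : ℂ) - 1‖ ^ 2 ≤ min 4 ((2 * Real.pi * t) ^ 2) := by
  refine le_min ?_ ?_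
  · have : ‖(Real.fourierChar t : ℂ) - 1‖ ≤ 2 := by
      refine (norm_sub_le _ _).trans ?_
      rw [Circle.norm_coe, norm_one]; norm_num
    nlinarith [norm_nonneg ((Real.fourierChar t : ℂ) - 1)]
  · rw [Real.fourierChar_apply, mul_comm, ← sq_abs (2 * Real.pi * t)]
    gcongr
    exact Real.norm_exp_I_mul_ofReal_sub_one_le

theorem lintegral_comp_smul_addHaar (μ : Measure V) [μ.IsAddHaarMeasure] {g : V → ℝ≥0∞}
    (hg : Measurable g) {r : ℝ} (hr : 0 < r) :
    ∫⁻ x, g (r • x) ∂μ = ENNReal.ofReal ((r ^ Module.finrank ℝ V)⁻¹) * ∫⁻ x, g x ∂μ := by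
  rw [← lintegral_map hg (measurable_const_smul r), Measure.map_addHaar_smul μ hr.ne',
    lintegral_smul_measure, abs_of_pos (by positivity), smul_eq_mul]

/-- The quadratic bound gives convergence at the origin because σ < 1, and the constant bound at
infinity because σ > 0. -/
theorem integrable_min_mul_rpow [Nontrivial V] {σ : ℝ} (hσ0 : 0 < σ) (hσ1 : σ < 1) :
    Integrable fun h : V =>
      min 4 (‖h‖ ^ 2) * ‖h‖ ^ (-((Module.finrank ℝ V : ℝ) + 2 * σ)) := by
  set d : ℝ := ((Module.finrank ℝ V : ℕ) : ℝ)
  have hd : 1 ≤ Module.finrank ℝ V := Module.finrank_pos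
  have hm : AEStronglyMeasurable (fun h : V => min 4 (‖h‖ ^ 2) * ‖h‖ ^ (-(d + 2 * σ))) volume := by
    refine Measurable.aestronglyMeasurable ?_
    fun_prop
  rw [← integrableOn_univ, ← union_compl_self (ball (0 : V) 1), integrableOn_union]
  constructor
  · refine integrableOn_ball_of_norm_le_rpow hd (C := 1) (α := d + 2 * σ - 2)
      (by simp only [d]; linarith) ?_ hm
    refine Eventually.of_forall fun h => ?_
    rcases eq_or_ne h 0 with rfl | h0
    · simp; positivity
    · have hp : 0 < ‖h‖ := norm_pos_iff.2 h0
      rw [Real.norm_of_nonneg (by positivity), one_mul,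
        show -(d + 2 * σ - 2) = 2 + -(d + 2 * σ) by ring, Real.rpow_add hp, Real.rpow_two]
      gcongr
      exact min_le_right _ _
  · have hi := (integrable_one_add_norm (E := V) (μ := volume) (r := d + 2 * σ)
      (by simp only [d]; linarith)).const_mul (4 * 2 ^ (d + 2 * σ))
    refine Integrable.mono' hi.integrableOn hm.restrict ?_
    refine (ae_restrict_iff' measurableSet_ball.compl).2 (Eventually.of_forall fun h hh => ?_)
    have h1 : 1 ≤ ‖h‖ := by simpa using hh
    have hd0 : 0 ≤ d + 2 * σ := by simp only [d]; positivity
    rw [Real.norm_of_nonneg (by positivity), mul_assoc]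
    refine mul_le_mul (min_le_left _ _) ?_ (by positivity) (by norm_num)
    rw [Real.rpow_neg (by positivity), Real.rpow_neg (by positivity), ← div_eq_mul_inv,
      ← one_div, div_le_div_iff₀ (by positivity) (by positivity), one_mul,
      ← Real.mul_rpow (by norm_num) (by positivity)]
    exact Real.rpow_le_rpow (by positivity) (by linarith) hd0

/-- The Fourier symbol of the Gagliardo energy is at most a multiple of `|ξ|^(2σ)`. -/
theorem exists_lintegral_fourierChar_sub_one_sq_le [Nontrivial V] {σ : ℝ} (hσ0 : 0 < σ)
    (hσ1 : σ < 1) :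
    ∃ C : ℝ≥0∞, C ≠ ⊤ ∧ ∀ ξ : V,
      ∫⁻ h : V, ‖(Real.fourierChar ⟪h, ξ⟫ : ℂ) - 1‖ₑ ^ 2 *
        ENNReal.ofReal (‖h‖ ^ (-((Module.finrank ℝ V : ℝ) + 2 * σ))) ≤
      C * ENNReal.ofReal ((2 * Real.pi * ‖ξ‖) ^ (2 * σ)) := by
  set d : ℝ := ((Module.finrank ℝ V : ℕ) : ℝ) with hd
  set φ : V → ℝ≥0∞ := fun h => ENNReal.ofReal (min 4 (‖h‖ ^ 2) * ‖h‖ ^ (-(d + 2 * σ))) with hφ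
  have hφm : Measurable φ := by fun_prop
  refine ⟨∫⁻ h, φ h, (integrable_min_mul_rpow hσ0 hσ1).lintegral_lt_top.ne, fun ξ => ?_⟩
  rcases eq_or_ne ξ 0 with rfl | hξ
  · simp
  set t : ℝ := 2 * Real.pi * ‖ξ‖ with ht
  have ht0 : 0 < t := by have := norm_pos_iff.2 hξ; positivity
  -- Rescaling by t = 2π|ξ| removes ξ from the integrand; the Jacobian t^(-d) leaves the factor
  -- t^(2σ).
  calc _ ≤ ∫⁻ h : V, ENNReal.ofReal (t ^ (d + 2 * σ)) * φ (t • h) := by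
        refine lintegral_mono fun h => ?_
        rw [← ofReal_norm, ← ENNReal.ofReal_pow (norm_nonneg _),
          ← ENNReal.ofReal_mul (by positivity), hφ, ← ENNReal.ofReal_mul (by positivity)]
        refine ENNReal.ofReal_le_ofReal ?_
        have e : t ^ (d + 2 * σ) * (min 4 (‖t • h‖ ^ 2) * ‖t • h‖ ^ (-(d + 2 * σ))) =
            min 4 (‖t • h‖ ^ 2) * ‖h‖ ^ (-(d + 2 * σ)) := by
          rw [norm_smul, Real.norm_of_nonneg ht0.le, Real.mul_rpow ht0.le (norm_nonneg _),
            Real.rpow_neg ht0.le]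
          field_simp
        rw [e]
        gcongr
        refine (norm_fourierChar_sub_one_sq_le _).trans (min_le_min_left _ ?_)
        rw [← sq_abs, norm_smul, Real.norm_of_nonneg ht0.le, abs_mul,
          abs_of_pos Real.two_pi_pos, ht, mul_assoc (2 * Real.pi) ‖ξ‖, mul_comm ‖ξ‖]
        gcongr
        exact abs_real_inner_le_norm _ _
    _ = ENNReal.ofReal (t ^ (d + 2 * σ)) *
          (ENNReal.ofReal ((t ^ Module.finrank ℝ V)⁻¹) * ∫⁻ h, φ h) := by
        rw [lintegral_const_mul' _ _ ENNReal.ofReal_ne_top,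
          lintegral_comp_smul_addHaar volume hφm ht0]
    _ = _ := by
        rw [← mul_assoc, ← ENNReal.ofReal_mul (by positivity), mul_comm]
        congr 2
        rw [Real.rpow_add ht0, hd, Real.rpow_natCast]
        field_simp

/-- Tonelli twice: Plancherel is applied for each fixed h, then the h-integral is the symbol at ξ.
-/
theorem exists_lintegral_gagliardoDensity_le [Nontrivial V] {σ : ℝ} (hσ0 : 0 < σ)
    (hσ1 : σ < 1) :
    ∃ C : ℝ≥0∞, C ≠ ⊤ ∧ ∀ f : V → ℝ, ContDiff ℝ ∞ f → HasCompactSupport f →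
      ∫⁻ y, gagliardoDensity σ f y ≤
        C * ∫⁻ ξ : V, ENNReal.ofReal ((2 * Real.pi * ‖ξ‖) ^ (2 * σ)) *
          ‖𝓕 (fun x => (f x : ℂ)) ξ‖ₑ ^ 2 := by
  obtain ⟨C, hC, H⟩ := exists_lintegral_fourierChar_sub_one_sq_le (V := V) hσ0 hσ1
  refine ⟨C, hC, fun f hf hc => ?_⟩
  have hfC : Continuous (𝓕 (fun x => (f x : ℂ))) :=
    (𝓕 ((hc.comp_left (g := ((↑) : ℝ → ℂ)) Complex.ofReal_zero).toSchwartzMap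
      (Complex.ofRealCLM.contDiff.comp hf))).continuous
  have hfm := hfC.measurable
  have hm := hf.continuous.measurable
  have hch : Continuous fun t : ℝ => (Real.fourierChar t : ℂ) := by fun_prop
  unfold gagliardoDensity
  set w : V → ℝ≥0∞ := fun h =>
    ENNReal.ofReal (‖h‖ ^ (-((Module.finrank ℝ V : ℝ) + 2 * σ))) with hw
  have hwm : Measurable w := by fun_prop
  calc _ = ∫⁻ h : V, ∫⁻ y : V, ‖f (y + h) - f y‖ₑ ^ 2 * w h := by
        refine lintegral_lintegral_swap (Measurable.aemeasurable ?_)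
        unfold Function.uncurry
        fun_prop
    _ = ∫⁻ h : V, ∫⁻ ξ : V, ‖(Real.fourierChar ⟪h, ξ⟫ : ℂ) - 1‖ₑ ^ 2 *
          ‖𝓕 (fun x => (f x : ℂ)) ξ‖ₑ ^ 2 * w h := by
        refine lintegral_congr fun h => ?_
        rw [lintegral_mul_const _ (by fun_prop), lintegral_enorm_sq_increment hf hc,
          lintegral_mul_const]
        have : Measurable fun ξ : V => (Real.fourierChar ⟪h, ξ⟫ : ℂ) :=
          (hch.comp (by fun_prop : Continuous fun ξ : V => ⟪h, ξ⟫)).measurable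
        fun_prop
    _ = ∫⁻ ξ : V, ∫⁻ h : V, ‖(Real.fourierChar ⟪h, ξ⟫ : ℂ) - 1‖ₑ ^ 2 *
          ‖𝓕 (fun x => (f x : ℂ)) ξ‖ₑ ^ 2 * w h := by
        refine lintegral_lintegral_swap (Measurable.aemeasurable ?_)
        unfold Function.uncurry
        have : Measurable fun p : V × V => (Real.fourierChar ⟪p.1, p.2⟫ : ℂ) :=
          (hch.comp (by fun_prop : Continuous fun p : V × V => ⟪p.1, p.2⟫)).measurable
        fun_prop
    _ ≤ ∫⁻ ξ : V, C * (ENNReal.ofReal ((2 * Real.pi * ‖ξ‖) ^ (2 * σ)) *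
          ‖𝓕 (fun x => (f x : ℂ)) ξ‖ₑ ^ 2) := by
        refine lintegral_mono fun ξ => ?_
        simp only [mul_right_comm _ (‖𝓕 (fun x => (f x : ℂ)) ξ‖ₑ ^ 2)]
        rw [lintegral_mul_const, ← mul_assoc]
        · gcongr
          exact H ξ
        · have : Measurable fun h : V => (Real.fourierChar ⟪h, ξ⟫ : ℂ) :=
            (hch.comp (by fun_prop : Continuous fun h : V => ⟪h, ξ⟫)).measurable
          fun_prop
    _ = _ := by
        rw [lintegral_const_mul]
        fun_prop

/-- The squared normalisation (2π)^(-n) is exactly cancelled by the Jacobian of ξ ↦ ξ/(2π). -/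
theorem fractionalEnergy_eq {n : ℕ} (σ : ℝ) {f : EuclideanSpace ℝ (Fin n) → ℝ}
    (hf : ContDiff ℝ ∞ f) (hc : HasCompactSupport f) :
    fractionalEnergy σ f = ∫⁻ ξ : EuclideanSpace ℝ (Fin n),
      ENNReal.ofReal ((2 * Real.pi * ‖ξ‖) ^ (2 * σ)) * ‖𝓕 (fun x => (f x : ℂ)) ξ‖ₑ ^ 2 := by
  have hfC : Continuous (𝓕 (fun x => (f x : ℂ))) :=
    (𝓕 ((hc.comp_left (g := ((↑) : ℝ → ℂ)) Complex.ofReal_zero).toSchwartzMap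
      (Complex.ofRealCLM.contDiff.comp hf))).continuous
  have hfm := hfC.measurable
  set Φ : EuclideanSpace ℝ (Fin n) → ℝ≥0∞ := fun ξ =>
    ENNReal.ofReal ((2 * Real.pi * ‖ξ‖) ^ (2 * σ)) * ‖𝓕 (fun x => (f x : ℂ)) ξ‖ₑ ^ 2 with hΦ
  have hΦm : Measurable Φ := by fun_prop
  have hpi : 0 < (2 * Real.pi)⁻¹ := inv_pos.2 Real.two_pi_pos
  calc fractionalEnergy σ f = ∫⁻ ξ : EuclideanSpace ℝ (Fin n),
        ENNReal.ofReal (((2 * Real.pi) ^ n)⁻¹) * Φ ((2 * Real.pi)⁻¹ • ξ) := by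
        refine lintegral_congr fun ξ => ?_
        rw [hΦ, fourierHat, norm_mul, Complex.norm_real, mul_pow, Real.norm_of_nonneg (by positivity),
          ← Real.rpow_natCast (_ ^ _), ← Real.rpow_mul Real.two_pi_pos.le,
          show -(n : ℝ) / 2 * ((2 : ℕ) : ℝ) = -(n : ℝ) by push_cast; ring,
          Real.rpow_neg Real.two_pi_pos.le, Real.rpow_natCast]
        simp only
        rw [norm_smul, Real.norm_of_nonneg hpi.le, mul_inv_cancel_left₀ Real.two_pi_pos.ne',
          ← ofReal_norm, ← ENNReal.ofReal_pow (norm_nonneg _),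
          ← ENNReal.ofReal_mul (by positivity), ← ENNReal.ofReal_mul (by positivity)]
        congr 1
        ring
    _ = ∫⁻ ξ, Φ ξ := by
        rw [lintegral_const_mul' _ _ ENNReal.ofReal_ne_top,
          lintegral_comp_smul_addHaar volume hΦm hpi, ← mul_assoc,
          ← ENNReal.ofReal_mul (by positivity), finrank_euclideanSpace_fin, inv_pow, inv_inv,
          inv_mul_cancel₀ (by positivity), ENNReal.ofReal_one, one_mul]

/-! ### Averages over balls -/

/-- **Jensen's inequality** for the square of the deviation of an average from a constant. -/
theorem enorm_setAverage_sub_sq_le {f : V → ℝ} (hf : Continuous f) {S : Set V}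
    (hS : IsCompact S) (h0 : volume S ≠ 0) (c : ℝ) :
    ‖(⨍ x in S, f x) - c‖ₑ ^ 2 ≤ (volume S)⁻¹ * ∫⁻ x in S, ‖f x - c‖ₑ ^ 2 := by
  have htop : volume S ≠ ⊤ := hS.measure_lt_top.ne
  have : IsFiniteMeasure (volume.restrict S) := ⟨by simpa using hS.measure_lt_top⟩
  have : NeZero (volume.restrict S) := ⟨by simpa using h0⟩
  have hint : ∀ g : V → ℝ, Continuous g → Integrable g (volume.restrict S) := fun g hg =>
    hg.continuousOn.integrableOn_compact hS
  have hcv : ConvexOn ℝ univ fun t : ℝ => (t - c) ^ 2 :=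
    ((even_two.convexOn_pow (𝕜 := ℝ)).translate_left (-c)).congr fun t _ => by
      simp [sub_eq_add_neg]
  have hJ := hcv.map_average_le (μ := volume.restrict S) (f := f) (by fun_prop) isClosed_univ
    (by simp) (hint f hf) (hint _ (by fun_prop))
  have key : ∀ a : ℝ, ‖a‖ₑ ^ 2 = ENNReal.ofReal (a ^ 2) := fun a => by
    rw [← ofReal_norm, ← ENNReal.ofReal_pow (norm_nonneg _), Real.norm_eq_abs, sq_abs]
  simp only [key]
  rw [← ofReal_integral_eq_lintegral_ofReal (hint _ (by fun_prop))
    (Eventually.of_forall fun x => sq_nonneg _)]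
  refine (ENNReal.ofReal_le_ofReal hJ).trans_eq ?_
  rw [setAverage_eq, smul_eq_mul, ENNReal.ofReal_mul (by positivity), Measure.real,
    ENNReal.ofReal_inv_of_pos (ENNReal.toReal_pos h0 htop), ENNReal.ofReal_toReal htop]

/-- Two points of the ball are at distance at most 2r, so the kernel there is at least (2r)^(-d-2σ).
-/
theorem lintegral_closedBall_enorm_sub_sq_le (σ : ℝ) (hσ0 : 0 ≤ σ) {f : V → ℝ}
    (hf : Continuous f) {x z : V} {r : ℝ} (hr : 0 < r) (hz : z ∈ closedBall x r) :
    ∫⁻ y in closedBall x r, ‖f y - f z‖ₑ ^ 2 ≤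
      ENNReal.ofReal ((2 * r) ^ ((Module.finrank ℝ V : ℝ) + 2 * σ)) * gagliardoDensity σ f z := by
  set p : ℝ := (Module.finrank ℝ V : ℝ) + 2 * σ with hp
  have hp0 : 0 ≤ p := by positivity
  have hfm := hf.measurable
  rw [← lintegral_indicator measurableSet_closedBall, ← lintegral_add_left_eq_self _ z,
    gagliardoDensity, ← lintegral_const_mul' _ _ ENNReal.ofReal_ne_top]
  refine lintegral_mono fun h => ?_
  by_cases hh : z + h ∈ closedBall x r
  · rw [indicator_of_mem hh]
    rcases eq_or_ne h 0 with rfl | h0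
    · simp
    have hpos : 0 < ‖h‖ := norm_pos_iff.2 h0
    have hle : ‖h‖ ≤ 2 * r := by
      have h1 := dist_triangle_right (z + h) z x
      rw [dist_eq_norm, add_sub_cancel_left] at h1
      have h2 := mem_closedBall.1 hh
      have h3 := mem_closedBall.1 hz
      linarith
    rw [mul_left_comm, ← ENNReal.ofReal_mul (by positivity)]
    refine le_mul_of_one_le_right zero_le ?_
    rw [ENNReal.one_le_ofReal, Real.rpow_neg hpos.le, ← div_eq_mul_inv,
      one_le_div (Real.rpow_pos_of_pos hpos _)]
    exact Real.rpow_le_rpow hpos.le hle hp0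
  · rw [indicator_of_notMem hh]
    exact zero_le

theorem measurable_gagliardoDensity (σ : ℝ) {f : V → ℝ} (hf : Continuous f) :
    Measurable (gagliardoDensity σ f) := by
  have hfm := hf.measurable
  refine Measurable.lintegral_prod_right' (f := fun p : V × V => ‖f (p.1 + p.2) - f p.1‖ₑ ^ 2 *
    ENNReal.ofReal (‖p.2‖ ^ (-((Module.finrank ℝ V : ℝ) + 2 * σ)))) ?_
  fun_prop

/-- Averages over concentric balls of radii `r / 2` and `r` differ by the local Gagliardo
energy. -/
theorem exists_enorm_setAverage_half_sub_sq_le (σ : ℝ) (hσ0 : 0 ≤ σ) :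
    ∃ C : ℝ, 0 < C ∧ ∀ f : V → ℝ, Continuous f → ∀ (x : V) (r : ℝ), 0 < r →
      ‖(⨍ y in closedBall x (r / 2), f y) - ⨍ y in closedBall x r, f y‖ₑ ^ 2 ≤
        ENNReal.ofReal (C * r ^ (2 * σ - Module.finrank ℝ V)) *
          ∫⁻ y in closedBall x r, gagliardoDensity σ f y := by
  set d : ℝ := ((Module.finrank ℝ V : ℕ) : ℝ) with hd
  set v : ℝ := (volume (ball (0 : V) 1)).toReal with hv
  have hvol : volume (ball (0 : V) 1) = ENNReal.ofReal v :=
    (ENNReal.ofReal_toReal measure_ball_lt_top.ne).symm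
  have hv0 : 0 < v :=
    ENNReal.toReal_pos (measure_ball_pos _ _ one_pos).ne' measure_ball_lt_top.ne
  refine ⟨2 ^ d * 2 ^ (d + 2 * σ) / v ^ 2, by positivity, fun f hf x r hr => ?_⟩
  have hball : ∀ ρ : ℝ, 0 < ρ → (volume (closedBall x ρ))⁻¹ = ENNReal.ofReal ((ρ ^ d * v)⁻¹) := by
    intro ρ hρ
    rw [Measure.addHaar_closedBall _ _ hρ.le, hvol, ← ENNReal.ofReal_mul (by positivity),
      ← ENNReal.ofReal_inv_of_pos (by positivity), hd, Real.rpow_natCast]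
  have hne : ∀ ρ : ℝ, 0 < ρ → volume (closedBall x ρ) ≠ 0 := fun ρ hρ =>
    (measure_closedBall_pos _ _ hρ).ne'
  have hm := measurable_gagliardoDensity σ hf
  calc _ ≤ (volume (closedBall x (r / 2)))⁻¹ * ∫⁻ z in closedBall x (r / 2),
          ‖f z - ⨍ y in closedBall x r, f y‖ₑ ^ 2 :=
        enorm_setAverage_sub_sq_le hf (isCompact_closedBall _ _) (hne _ (by positivity)) _
    _ ≤ (volume (closedBall x (r / 2)))⁻¹ * ∫⁻ z in closedBall x (r / 2),
          (volume (closedBall x r))⁻¹ *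
            (ENNReal.ofReal ((2 * r) ^ (d + 2 * σ)) * gagliardoDensity σ f z) := by
        gcongr 1
        refine setLIntegral_mono (by fun_prop) fun z hz => ?_
        rw [enorm_sub_rev]
        refine (enorm_setAverage_sub_sq_le hf (isCompact_closedBall _ _) (hne _ hr) _).trans ?_
        gcongr 1
        exact lintegral_closedBall_enorm_sub_sq_le σ hσ0 hf hr
          (closedBall_subset_closedBall (by linarith) hz)
    _ = ENNReal.ofReal (((r / 2) ^ d * v)⁻¹) * (ENNReal.ofReal ((r ^ d * v)⁻¹) *
          (ENNReal.ofReal ((2 * r) ^ (d + 2 * σ)) *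
            ∫⁻ z in closedBall x (r / 2), gagliardoDensity σ f z)) := by
        rw [hball _ hr, hball _ (by positivity), lintegral_const_mul' _ _ ENNReal.ofReal_ne_top,
          lintegral_const_mul' _ _ ENNReal.ofReal_ne_top]
    _ ≤ ENNReal.ofReal (((r / 2) ^ d * v)⁻¹) * (ENNReal.ofReal ((r ^ d * v)⁻¹) *
          (ENNReal.ofReal ((2 * r) ^ (d + 2 * σ)) *
            ∫⁻ z in closedBall x r, gagliardoDensity σ f z)) := by
        gcongr
        linarith
    _ = _ := by
        rw [← mul_assoc, ← mul_assoc, ← ENNReal.ofReal_mul (by positivity),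
          ← ENNReal.ofReal_mul (by positivity)]
        congr 2
        rw [Real.div_rpow hr.le (by norm_num), Real.mul_rpow (by norm_num) hr.le,
          Real.rpow_add hr, Real.rpow_sub hr]
        field_simp

theorem tendsto_setAverage_closedBall {f : V → ℝ} (hf : Continuous f) (x : V) {r : ℕ → ℝ}
    (hr0 : ∀ j, 0 < r j) (hr : Tendsto r atTop (𝓝 0)) :
    Tendsto (fun j => ⨍ y in closedBall x (r j), f y) atTop (𝓝 (f x)) := by
  rw [Metric.tendsto_atTop]
  intro ε hε
  obtain ⟨δ, hδ, H⟩ := Metric.continuous_iff.1 hf x (ε / 2) (half_pos hε)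
  obtain ⟨N, hN⟩ := (hr.eventually (gt_mem_nhds hδ)).exists_forall_of_atTop
  refine ⟨N, fun j hj => ?_⟩
  have hmem : (⨍ y in closedBall x (r j), f y) ∈ closedBall (f x) (ε / 2) := by
    refine (convex_closedBall (f x) (ε / 2)).set_average_mem isClosed_closedBall
      (measure_closedBall_pos _ _ (hr0 j)).ne' measure_closedBall_lt_top.ne ?_
      (hf.continuousOn.integrableOn_compact (isCompact_closedBall _ _))
    refine (ae_restrict_iff' measurableSet_closedBall).2 (Eventually.of_forall fun y hy => ?_)
    exact (H y ((mem_closedBall.1 hy).trans_lt (hN j hj))).le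
  exact (mem_closedBall.1 hmem).trans_lt (half_lt_self hε)

theorem tendsto_setAverage_closedBall_zero [Nontrivial V] {f : V → ℝ} (hf : Integrable f) (x : V)
    {r : ℕ → ℝ} (hr0 : ∀ j, 0 < r j) (hr : Tendsto r atTop atTop) :
    Tendsto (fun j => ⨍ y in closedBall x (r j), f y) atTop (𝓝 0) := by
  set v : ℝ := (volume (ball (0 : V) 1)).toReal with hv
  have hv0 : 0 < v :=
    ENNReal.toReal_pos (measure_ball_pos _ _ one_pos).ne' measure_ball_lt_top.ne
  have hd : Module.finrank ℝ V ≠ 0 := Module.finrank_pos.ne'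
  have hb : ∀ j, ‖⨍ y in closedBall x (r j), f y‖ ≤
      (r j ^ Module.finrank ℝ V * v)⁻¹ * ∫ y, ‖f y‖ := by
    intro j
    rw [setAverage_eq, norm_smul, Real.norm_of_nonneg (by positivity), Measure.real,
      Measure.addHaar_closedBall _ _ (hr0 j).le, ENNReal.toReal_mul,
      ENNReal.toReal_ofReal (pow_nonneg (hr0 j).le _)]
    gcongr
    · have := hr0 j
      positivity
    · exact (norm_integral_le_integral_norm _).trans
        (setIntegral_le_integral hf.norm (Eventually.of_forall fun _ => norm_nonneg _))
  refine squeeze_zero_norm hb ?_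
  rw [← zero_mul (∫ y, ‖f y‖)]
  exact ((((tendsto_pow_atTop hd).comp hr).atTop_mul_const hv0).inv_tendsto_atTop).mul_const _

/-- The value of a test function is controlled by the differences of its averages over all
dyadic scales. -/
theorem abs_le_tsum_setAverage_differences [Nontrivial V] {f : V → ℝ} (hf : Continuous f)
    (hi : Integrable f) (x : V) {R : ℝ} (hR : 0 < R) {p q : ℕ → ℝ} (hp : Summable p)
    (hq : Summable q)
    (hpb : ∀ j : ℕ, |(⨍ y in closedBall x (R * (1 / 2) ^ j / 2), f y) -
      ⨍ y in closedBall x (R * (1 / 2) ^ j), f y| ≤ p j)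
    (hqb : ∀ j : ℕ, |(⨍ y in closedBall x (R * 2 ^ (j + 1) / 2), f y) -
      ⨍ y in closedBall x (R * 2 ^ (j + 1)), f y| ≤ q j) :
    |f x| ≤ ∑' j, p j + ∑' j, q j := by
  have h1 : Tendsto (fun j : ℕ => R * (1 / 2 : ℝ) ^ j) atTop (𝓝 0) := by
    simpa using (tendsto_pow_atTop_nhds_zero_of_lt_one (r := (1 / 2 : ℝ)) (by norm_num)
      (by norm_num)).const_mul R
  have h2 : Tendsto (fun j : ℕ => R * (2 : ℝ) ^ j) atTop atTop :=
    (tendsto_pow_atTop_atTop_of_one_lt one_lt_two).const_mul_atTop hR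
  have hP := dist_le_tsum_of_dist_le_of_tendsto₀ p (fun j => by
      rw [dist_comm, Real.dist_eq]
      convert hpb j using 5
      rw [Nat.succ_eq_add_one, pow_succ]; ring_nf) hp
    (tendsto_setAverage_closedBall hf x (fun j => by positivity) h1)
  have hQ := dist_le_tsum_of_dist_le_of_tendsto₀ q (fun j => by
      rw [Real.dist_eq]
      convert hqb j using 5
      rw [pow_succ]; ring_nf) hq
    (tendsto_setAverage_closedBall_zero hi x (fun j => by positivity) h2)
  simp only [pow_zero, mul_one] at hP hQ
  rw [Real.dist_eq] at hP hQ
  rw [sub_zero] at hQ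
  have := abs_sub_abs_le_abs_sub (f x) (⨍ y in closedBall x R, f y)
  rw [abs_sub_comm] at this
  linarith

/-! ### Concentration of energy -/

theorem mul_pow_rpow_eq_sq {R c e : ℝ} (hR : 0 < R) (hc : 0 < c) (j : ℕ) :
    (R * c ^ j) ^ e = (√(R ^ e) * (c ^ (e / 2)) ^ j) ^ 2 := by
  rw [mul_pow, Real.sq_sqrt (by positivity), Real.mul_rpow hR.le (by positivity), ← pow_mul,
    mul_comm j 2, pow_mul, ← Real.rpow_natCast (c ^ (e / 2)) 2, ← Real.rpow_mul hc.le,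
    ← Real.rpow_natCast c j, ← Real.rpow_natCast (c ^ _) j, ← Real.rpow_mul hc.le,
    ← Real.rpow_mul hc.le]
  congr 2
  push_cast
  ring

/-- A test function of small Gagliardo energy can only be large at points around which the energy
concentrates at small scales. -/
theorem exists_radius_lintegral_gagliardoDensity_ge [Nontrivial V] {σ s R : ℝ} (hσ : 0 ≤ σ)
    (hσd : 2 * σ < Module.finrank ℝ V) (hs : Module.finrank ℝ V - 2 * σ < s) (hR : 0 < R) :
    ∃ δ : ℝ, 0 < δ ∧ ∀ f : V → ℝ, Continuous f → HasCompactSupport f →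
      ∫⁻ y, gagliardoDensity σ f y ≤ ENNReal.ofReal δ → ∀ x, 1 ≤ f x →
        ∃ r, 0 < r ∧ r ≤ R ∧
          ENNReal.ofReal (δ * r ^ s) ≤ ∫⁻ y in closedBall x r, gagliardoDensity σ f y := by
  obtain ⟨C, hC, H⟩ := exists_enorm_setAverage_half_sub_sq_le (V := V) σ hσ
  set d : ℝ := ((Module.finrank ℝ V : ℕ) : ℝ) with hd
  set γ : ℝ := 2 * σ - d + s with hγ
  have hγ0 : 0 < γ := by linarith
  have hθ0 : 2 * σ - d < 0 := by linarith
  set a : ℝ := (1 / 2 : ℝ) ^ (γ / 2) with ha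
  set b : ℝ := (2 : ℝ) ^ ((2 * σ - d) / 2) with hb
  have ha0 : 0 < a := by positivity
  have hb0 : 0 < b := by positivity
  have ha1 : a < 1 := Real.rpow_lt_one (by norm_num) (by norm_num) (by linarith)
  have hb1 : b < 1 := Real.rpow_lt_one_of_one_lt_of_neg one_lt_two (by linarith)
  set A : ℝ := √C * √(R ^ γ) with hA
  set B : ℝ := √C * √(R ^ (2 * σ - d)) with hB
  have hA0 : 0 ≤ A := by positivity
  have hB0 : 0 ≤ B := by positivity
  set K : ℝ := A * (1 - a)⁻¹ + B * (1 - b)⁻¹ with hK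
  have hK0 : 0 ≤ K := by
    have h1 : 0 ≤ (1 - a)⁻¹ := inv_nonneg.2 (by linarith)
    have h2 : 0 ≤ (1 - b)⁻¹ := inv_nonneg.2 (by linarith)
    positivity
  -- K bounds the sum of all dyadic differences per unit of η; this η makes the total ηK < 1.
  set η : ℝ := (K + 1)⁻¹ with hη
  have hη0 : 0 < η := by positivity
  have hηK : η * K < 1 := by
    rw [hη, inv_mul_lt_iff₀ (by positivity)]; linarith
  refine ⟨η ^ 2, by positivity, fun f hf hc hE x hx => ?_⟩
  by_contra! hcon
  have step : ∀ r m t : ℝ, 0 < r → 0 ≤ m → 0 ≤ t →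
      ∫⁻ y in closedBall x r, gagliardoDensity σ f y ≤ ENNReal.ofReal m →
      C * r ^ (2 * σ - d) * m ≤ t ^ 2 →
      |(⨍ y in closedBall x (r / 2), f y) - ⨍ y in closedBall x r, f y| ≤ t := by
    intro r m t hr hm ht h1 h2
    have h3 := (H f hf x r hr).trans (mul_le_mul_right h1 _)
    rw [← ENNReal.ofReal_mul (by positivity), ← ofReal_norm,
      ← ENNReal.ofReal_pow (norm_nonneg _), ENNReal.ofReal_le_ofReal_iff (by positivity)] at h3
    exact abs_le_of_sq_le_sq (by simpa using h3.trans h2) ht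
  have hsmall : |f x| ≤ ∑' j : ℕ, η * A * a ^ j + ∑' j : ℕ, η * B * b ^ j := by
    refine abs_le_tsum_setAverage_differences hf (hf.integrable_of_hasCompactSupport hc) x hR
      ((summable_geometric_of_lt_one ha0.le ha1).mul_left _)
      ((summable_geometric_of_lt_one hb0.le hb1).mul_left _) (fun j => ?_) (fun j => ?_)
    -- Small scales: the negated conclusion bounds the local energy by η² r^s.
    · have hr : 0 < R * (1 / 2 : ℝ) ^ j := by positivity
      have hrR : R * (1 / 2 : ℝ) ^ j ≤ R :=
        mul_le_of_le_one_right hR.le (pow_le_one₀ (by norm_num) (by norm_num))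
      refine step _ (η ^ 2 * (R * (1 / 2 : ℝ) ^ j) ^ s) _ hr (by positivity) (by positivity)
        (hcon _ hr hrR).le (le_of_eq ?_)
      calc _ = C * η ^ 2 * (R * (1 / 2 : ℝ) ^ j) ^ γ := by
            rw [hγ, Real.rpow_add hr]; ring
        _ = _ := by
            rw [mul_pow_rpow_eq_sq hR (by norm_num), hA]
            simp only [mul_pow]
            rw [Real.sq_sqrt hC.le]
            ring
    -- Large scales: only the total energy bound η² is needed.
    · have hr : 0 < R * (2 : ℝ) ^ (j + 1) := by positivity
      refine step _ (η ^ 2) _ hr (by positivity) (by positivity)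
        ((setLIntegral_le_lintegral _ _).trans hE) ?_
      calc _ = (η * B * b ^ (j + 1)) ^ 2 := by
            rw [mul_pow_rpow_eq_sq hR (by norm_num), hB]
            simp only [mul_pow]
            rw [Real.sq_sqrt hC.le]
            ring
        _ ≤ _ := by
            gcongr ?_ ^ 2
            exact mul_le_mul_of_nonneg_left
              (pow_le_pow_of_le_one hb0.le hb1.le (Nat.le_succ j)) (by positivity)
  rw [tsum_mul_left, tsum_mul_left, tsum_geometric_of_lt_one ha0.le ha1,
    tsum_geometric_of_lt_one hb0.le hb1] at hsmall
  have : η * A * (1 - a)⁻¹ + η * B * (1 - b)⁻¹ = η * K := by rw [hK]; ring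
  linarith [le_abs_self (f x)]

/-! ### Covering and Hausdorff measure -/

/-- The **Vitali covering** argument: a compact set carrying test functions `≥ 1` of arbitrarily
small Gagliardo energy is covered by finitely many small balls with small `s`-th power sum of
radii. -/
theorem exists_finset_cover_sum_rpow_le [Nontrivial V] {σ s : ℝ} (hσ : 0 ≤ σ)
    (hσd : 2 * σ < Module.finrank ℝ V) (hs : Module.finrank ℝ V - 2 * σ < s) {Λ : Set V}
    (hΛ : IsCompact Λ)
    (hf : ∀ ε : ℝ, 0 < ε → ∃ f : V → ℝ, Continuous f ∧ HasCompactSupport f ∧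
      (∀ x ∈ Λ, 1 ≤ f x) ∧ ∫⁻ y, gagliardoDensity σ f y ≤ ENNReal.ofReal ε)
    {R ε : ℝ} (hR : 0 < R) (hε : 0 < ε) :
    ∃ (u : Finset V) (ρ : V → ℝ), (∀ b ∈ u, 0 < ρ b ∧ ρ b ≤ R) ∧
      Λ ⊆ ⋃ b ∈ u, closedBall b (5 * ρ b) ∧
      ∑ b ∈ u, ENNReal.ofReal (ρ b ^ s) ≤ ENNReal.ofReal ε := by
  obtain ⟨δ, hδ, H⟩ := exists_radius_lintegral_gagliardoDensity_ge (V := V) hσ hσd hs hR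
  -- The bound δ allows the concentration lemma; the bound δε leaves ε after division by δ.
  obtain ⟨f, hfc, hfs, hf1, hfE⟩ := hf (min δ (δ * ε)) (by positivity)
  have H' := fun x (hx : x ∈ Λ) => H f hfc hfs
    (hfE.trans (ENNReal.ofReal_le_ofReal (min_le_left _ _))) x (hf1 x hx)
  choose! ρ hρ0 hρR hρ using H'
  obtain ⟨t, htΛ, ht⟩ := hΛ.elim_nhds_subcover (fun x => closedBall x (ρ x))
    fun x hx => closedBall_mem_nhds x (hρ0 x hx)
  obtain ⟨u, hut, hdis, hcov⟩ := Vitali.exists_disjoint_subfamily_covering_enlargement_closedBall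
    (t : Set V) id ρ R (fun a ha => hρR a (htΛ a ha)) 5 (by norm_num)
  have hfin : u.Finite := t.finite_toSet.subset hut
  have huΛ : ∀ b ∈ u, b ∈ Λ := fun b hb => htΛ b (hut hb)
  refine ⟨hfin.toFinset, ρ, fun b hb => ?_, fun x hx => ?_, ?_⟩
  · have := huΛ b (hfin.mem_toFinset.1 hb)
    exact ⟨hρ0 b this, hρR b this⟩
  · obtain ⟨a, ha, hxa⟩ := mem_iUnion₂.1 (ht hx)
    obtain ⟨b, hb, hab⟩ := hcov a ha
    exact mem_iUnion₂.2 ⟨b, hfin.mem_toFinset.2 hb, hab hxa⟩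
  · have hsum : ∑ b ∈ hfin.toFinset, ENNReal.ofReal (δ * ρ b ^ s) ≤ ENNReal.ofReal (δ * ε) :=
      calc _ ≤ ∑ b ∈ hfin.toFinset, ∫⁻ y in closedBall b (ρ b), gagliardoDensity σ f y :=
            Finset.sum_le_sum fun b hb => hρ b (huΛ b (hfin.mem_toFinset.1 hb))
        _ = ∫⁻ y in ⋃ b ∈ hfin.toFinset, closedBall b (ρ b), gagliardoDensity σ f y := by
            rw [lintegral_biUnion_finset]
            · simpa using hdis
            · exact fun b _ => measurableSet_closedBall
        _ ≤ _ := (setLIntegral_le_lintegral _ _).trans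
            (hfE.trans (ENNReal.ofReal_le_ofReal (min_le_right _ _)))
    simp only [ENNReal.ofReal_mul hδ.le] at hsum
    rw [← Finset.mul_sum] at hsum
    exact (ENNReal.mul_le_mul_iff_right (ENNReal.ofReal_pos.2 hδ).ne'
      ENNReal.ofReal_ne_top).1 hsum

theorem hausdorffMeasure_eq_zero_of_gagliardoDensity [Nontrivial V] {σ s : ℝ} (hσ : 0 ≤ σ)
    (hσd : 2 * σ < Module.finrank ℝ V) (hs : Module.finrank ℝ V - 2 * σ < s) {Λ : Set V}
    (hΛ : IsCompact Λ)
    (hf : ∀ ε : ℝ, 0 < ε → ∃ f : V → ℝ, Continuous f ∧ HasCompactSupport f ∧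
      (∀ x ∈ Λ, 1 ≤ f x) ∧ ∫⁻ y, gagliardoDensity σ f y ≤ ENNReal.ofReal ε) :
    Measure.hausdorffMeasure s Λ = 0 := by
  have hs0 : 0 < s := by linarith
  -- Radii and power sums tend to 0 together; the factor 10 below is the diameter of a fivefold
  -- enlarged ball.
  have H := fun m : ℕ => exists_finset_cover_sum_rpow_le hσ hσd hs hΛ hf
    (R := 1 / ((m : ℝ) + 1)) (ε := 1 / ((m : ℝ) + 1)) Nat.one_div_pos_of_nat Nat.one_div_pos_of_nat
  choose u ρ hρ hcov hsum using H
  have hlim : ∀ c : ℝ, Tendsto (fun m : ℕ => ENNReal.ofReal (c * (1 / ((m : ℝ) + 1)))) atTop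
      (𝓝 0) := fun c => by
    simpa using ENNReal.tendsto_ofReal (tendsto_one_div_add_atTop_nhds_zero_nat.const_mul c)
  have hdiam : ∀ m, ∀ b ∈ u m, ediam (closedBall b (5 * ρ m b)) ≤
      ENNReal.ofReal (10 * ρ m b) := fun m b hb => by
    rw [← Metric.closedEBall_ofReal (by have := (hρ m b hb).1; positivity)]
    refine ediam_closedEBall_le.trans_eq ?_
    rw [← ENNReal.ofReal_ofNat, ← ENNReal.ofReal_mul (by norm_num)]
    congr 1; ring
  have key := Measure.hausdorffMeasure_le_liminf_sum s Λ (l := atTop) (ι := fun m => u m) _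
    (hlim 10) (fun m b => closedBall (b : V) (5 * ρ m b))
    (Eventually.of_forall fun m b => (hdiam m b b.2).trans (ENNReal.ofReal_le_ofReal
      (mul_le_mul_of_nonneg_left (hρ m b b.2).2 (by norm_num))))
    (Eventually.of_forall fun m => by
      rw [iUnion_subtype]; exact hcov m)
  refine le_antisymm (key.trans ?_) zero_le
  rw [← (hlim (10 ^ s)).liminf_eq]
  refine liminf_le_liminf (Eventually.of_forall fun m => ?_)
  calc _ ≤ ∑ b : u m, ENNReal.ofReal (10 ^ s) * ENNReal.ofReal (ρ m b ^ s) :=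
        Finset.sum_le_sum fun b _ => by
          have hb := (hρ m b b.2).1
          rw [← ENNReal.ofReal_mul (by positivity), ← Real.mul_rpow (by norm_num) hb.le,
            ← ENNReal.ofReal_rpow_of_nonneg (by positivity) hs0.le]
          exact ENNReal.rpow_le_rpow (hdiam m b b.2) hs0.le
    _ ≤ _ := by
        rw [← Finset.mul_sum, Finset.sum_coe_sort (u m) fun b => ENNReal.ofReal (ρ m b ^ s),
          ENNReal.ofReal_mul (by positivity)]
        gcongr
        exact hsum m

end FractionalCapacity

theorem theorem2p4 (n : ℕ) (hn : 2 ≤ n) (σ : ℝ) (hσ0 : 0 < σ) (hσ1 : σ < 1)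
    (Λ : Set (EuclideanSpace ℝ (Fin n))) (hΛ : IsCompact Λ)
    (hcap : fractionalCapacity σ Λ = 0) :
    (∀ s : ℝ, (n : ℝ) - 2 * σ < s → Measure.hausdorffMeasure s Λ = 0) ∧
      dimH Λ ≤ ENNReal.ofReal ((n : ℝ) - 2 * σ) := by
  have hn2 : (2 : ℝ) ≤ n := by exact_mod_cast hn
  have hfr : Module.finrank ℝ (EuclideanSpace ℝ (Fin n)) = n := finrank_euclideanSpace_fin
  have : Nontrivial (EuclideanSpace ℝ (Fin n)) :=
    Module.nontrivial_of_finrank_pos (R := ℝ) (by omega)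
  obtain ⟨C, hC, H⟩ := exists_lintegral_gagliardoDensity_le (V := EuclideanSpace ℝ (Fin n)) hσ0 hσ1
  have hsmall : ∀ ε : ℝ, 0 < ε → ∃ f : EuclideanSpace ℝ (Fin n) → ℝ, Continuous f ∧
      HasCompactSupport f ∧ (∀ x ∈ Λ, 1 ≤ f x) ∧
      ∫⁻ y, gagliardoDensity σ f y ≤ ENNReal.ofReal ε := by
    intro ε hε
    -- κ is an energy threshold small enough that even after the comparison constant C it stays
    -- below ε.
    obtain ⟨κ, hκ, hκε⟩ := ENNReal.exists_nnreal_pos_mul_lt hC (ENNReal.ofReal_pos.2 hε).ne'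
    have hlt : fractionalCapacity σ Λ < κ := hcap ▸ ENNReal.coe_pos.2 hκ
    obtain ⟨E, ⟨f, hf, hfc, hf1, rfl⟩, hE⟩ := sInf_lt_iff.1 hlt
    refine ⟨f, hf.continuous, hfc, hf1, (H f hf hfc).trans ?_⟩
    rw [← fractionalEnergy_eq σ hf hfc, mul_comm]
    exact (mul_le_mul_left hE.le C).trans hκε.le
  have hzero : ∀ s : ℝ, (n : ℝ) - 2 * σ < s → Measure.hausdorffMeasure s Λ = 0 := fun s hs =>
    hausdorffMeasure_eq_zero_of_gagliardoDensity hσ0.le (by rw [hfr]; linarith)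
      (by rwa [hfr]) hΛ hsmall
  refine ⟨hzero, dimH_le fun d' hd' => ?_⟩
  by_contra! hlt
  have := hzero d' (Real.toNNReal_lt_iff_lt_coe (by linarith) |>.1 (ENNReal.coe_lt_coe.1 hlt))
  simp [this] at hd'
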